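/- Let $p$ be a prime and let $X$ be a simply connected based CW-complex that is $p$-local (each homotopy group $\pi_n(X)$, $n\ge 1$, is uniquely divisible by every integer prime to $p$) and such that each reduced integral homology group of $X$ is a finitely generated module over $\mathbb{Z}_{(p)}$, the integers localized at $p$. Let $[X,X]$ be the monoid of based homotopy classes of based maps $X\to X$ and let $\mathcal{E}(X)\subseteq[X,X]$ be the group of classes of based self-homotopy equivalences. For $k\ge 0$ put \[\mathcal{A}_*^{k}(X;p)=\{f\in[X,X] : f_*\colon \tilde H_i(X;\mathbb{Z}/p)\to \tilde H_i(X;\mathbb{Z}/p)\text{ is an isomorphism for all } i\le k\},\] \[\mathcal{A}^*_{k}(X;p)=\{f\in[X,X] : f^*\colon \tilde H^i(X;\mathbb{Z}/p)\to \tilde H^i(X;\mathbb{Z}/p)\text{ is an isomorphism for all } i\le k\},\] where $\tilde H$ denotes reduced singular (co)homology, and define the mod $p$ homology and cohomology self-closeness numbers of $X$ by \[N_*\mathcal{E}(X;p)=\min\{k\ge 0 : \mathcal{A}_*^{k}(X;p)=\mathcal{E}(X)\},\qquad N^*\mathcal{E}(X;p)=\min\{k\ge 0 : \mathcal{A}^*_{k}(X;p)=\mathcal{E}(X)\},\]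 with the convention $\min\emptyset=+\infty$. Then \[N^*\mathcal{E}(X;p)=N_*\mathcal{E}(X;p).\] -/

import Mathlib

open CategoryTheory

noncomputable section

namespace SelfCloseness

universe u

/-! ### Based maps and based homotopy classes -/

section Based

variable {X : Type u} [TopologicalSpace X] {Y : Type u} [TopologicalSpace Y]
  {Z : Type u} [TopologicalSpace Z]

/-- Based maps `(X, x₀) → (Y, y₀)`. -/
structure BasedMap (x₀ : X) (y₀ : Y) : Type u where
  /-- the underlying continuous map -/
  toMap : C(X, Y)
  map_base : toMap x₀ = y₀

/-- Based homotopy: homotopy relative to the base point. -/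
instance basedSetoid (x₀ : X) (y₀ : Y) : Setoid (BasedMap x₀ y₀) where
  r f g := ContinuousMap.HomotopicRel f.toMap g.toMap {x₀}
  iseqv :=
    ⟨fun f => ContinuousMap.HomotopicRel.refl f.toMap, fun h => h.symm, fun h k => h.trans k⟩

/-- `[X, Y]`, the set of based homotopy classes of based maps. -/
def BasedClass (x₀ : X) (y₀ : Y) : Type u := Quotient (basedSetoid x₀ y₀)

/-- The class of the identity map. -/
def BasedClass.id (x₀ : X) : BasedClass x₀ x₀ :=
  Quotient.mk (basedSetoid x₀ x₀) ⟨ContinuousMap.id X, rfl⟩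

/-- Composition of based maps (`g` after `f`). -/
def BasedMap.comp {x₀ : X} {y₀ : Y} {z₀ : Z} (g : BasedMap y₀ z₀) (f : BasedMap x₀ y₀) :
    BasedMap x₀ z₀ :=
  ⟨g.toMap.comp f.toMap, by rw [ContinuousMap.comp_apply, f.map_base, g.map_base]⟩

/-- Composition of based homotopy classes (`β` after `α`). -/
def BasedClass.comp {x₀ : X} {y₀ : Y} {z₀ : Z} (β : BasedClass y₀ z₀) (α : BasedClass x₀ y₀) :
    BasedClass x₀ z₀ :=
  Quotient.map₂ (sa := basedSetoid y₀ z₀) (sb := basedSetoid x₀ y₀) (sc := basedSetoid x₀ z₀)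
    BasedMap.comp
    (by
      rintro g g' ⟨G⟩ f f' ⟨F⟩
      refine ⟨⟨ContinuousMap.Homotopy.comp G.toHomotopy F.toHomotopy, ?_⟩⟩
      intro t x hx
      have h1 : F.toHomotopy (t, x) = y₀ := by
        have := F.eq_fst t hx
        rw [Set.mem_singleton_iff.1 hx] at this ⊢
        exact this.trans f.map_base
      have h2 : G.toHomotopy (t, y₀) = z₀ := (G.eq_fst t (Set.mem_singleton y₀)).trans g.map_base
      have h3 : (BasedMap.comp g f).toMap x = z₀ := by
        rw [Set.mem_singleton_iff.1 hx]
        exact (BasedMap.comp g f).map_base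
      refine Eq.trans ?_ h3.symm
      change G.toHomotopy (t, F.toHomotopy (t, x)) = z₀
      rw [h1, h2]) β α

/-- `𝓔(X)`: the classes of based self-homotopy equivalences, i.e. the invertible elements of the
monoid `[X, X]`. -/
def selfEquivalences (x₀ : X) : Set (BasedClass x₀ x₀) :=
  {α | ∃ β : BasedClass x₀ x₀,
    BasedClass.comp β α = BasedClass.id x₀ ∧ BasedClass.comp α β = BasedClass.id x₀}

end Based

/-! ### Singular homology and cohomology with coefficients in an abelian group -/

/-- The singular chain complex `C_*(-; G)`. -/
abbrev chains (G : AddCommGrpCat.{u}) : TopCat.{u} ⥤ ChainComplex AddCommGrpCat.{u} ℕ :=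
  (AlgebraicTopology.singularChainComplexFunctor AddCommGrpCat.{u}).obj G

/-- The additive group `ℤ`, in the universe `u`. -/
abbrev intCoeff : AddCommGrpCat.{u} := AddCommGrpCat.of (ULift.{u} ℤ)

/-- The additive group `ℤ/p`, in the universe `u`. -/
abbrev modCoeff (p : ℕ) : AddCommGrpCat.{u} := AddCommGrpCat.of (ULift.{u} (ZMod p))

/-- The singular cochain complex `Hom(C_*(-; ℤ), G)`. -/
abbrev cochains (G : AddCommGrpCat.{u}) :
    TopCat.{u}ᵒᵖ ⥤ HomologicalComplex AddCommGrpCat.{u} (ComplexShape.down ℕ).symm :=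
  (chains intCoeff).op ⋙ HomologicalComplex.opFunctor AddCommGrpCat.{u} (ComplexShape.down ℕ) ⋙
    (preadditiveYoneda.obj G).mapHomologicalComplex (ComplexShape.down ℕ).symm

/-- Unreduced singular homology `H_n(-; G)`. -/
abbrev homology (G : AddCommGrpCat.{u}) (n : ℕ) : TopCat.{u} ⥤ AddCommGrpCat.{u} :=
  chains G ⋙ HomologicalComplex.homologyFunctor AddCommGrpCat.{u} (ComplexShape.down ℕ) n

/-- Unreduced singular cohomology `H^n(-; G)`. -/
abbrev cohomology (G : AddCommGrpCat.{u}) (n : ℕ) : TopCat.{u}ᵒᵖ ⥤ AddCommGrpCat.{u} :=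
  cochains G ⋙
    HomologicalComplex.homologyFunctor AddCommGrpCat.{u} (ComplexShape.down ℕ).symm n

/-- The one-point space. -/
abbrev point : TopCat.{u} := TopCat.of PUnit.{u + 1}

/-- The map from a space to the one-point space. -/
abbrev collapse (X : Type u) [TopologicalSpace X] : TopCat.of X ⟶ point :=
  TopCat.ofHom (ContinuousMap.const X PUnit.unit)

/-- The inclusion of the base point. -/
abbrev basePoint {X : Type u} [TopologicalSpace X] (x₀ : X) : point ⟶ TopCat.of X :=
  TopCat.ofHom (ContinuousMap.const PUnit x₀)

/-- Reduced homology `H̃_n(X; G) = ker (H_n(X; G) → H_n(pt; G))`. -/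
def reducedHomology (G : AddCommGrpCat.{u}) (n : ℕ) (X : Type u) [TopologicalSpace X] :
    AddCommGrpCat.{u} :=
  Limits.kernel ((homology G n).map (collapse X))

/-- Reduced cohomology of a based space, `H̃^n(X; G) = ker (H^n(X; G) → H^n({x₀}; G))`. -/
def reducedCohomology (G : AddCommGrpCat.{u}) (n : ℕ) {X : Type u} [TopologicalSpace X]
    (x₀ : X) : AddCommGrpCat.{u} :=
  Limits.kernel ((cohomology G n).map (basePoint x₀).op)

section Induced

variable {X : Type u} [TopologicalSpace X] {Y : Type u} [TopologicalSpace Y]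

/-- The homomorphism `f_*` induced by a map on reduced homology. -/
def reducedHomologyMap (G : AddCommGrpCat.{u}) (n : ℕ) (f : C(X, Y)) :
    reducedHomology G n X ⟶ reducedHomology G n Y :=
  Limits.kernel.map _ _ ((homology G n).map (TopCat.ofHom f)) (𝟙 _) (by
    rw [Category.comp_id, ← Functor.map_comp]
    rfl)

/-- The homomorphism `f^*` induced by a based map on reduced cohomology. -/
def reducedCohomologyMap (G : AddCommGrpCat.{u}) (n : ℕ) {x₀ : X} {y₀ : Y}
    (f : BasedMap x₀ y₀) : reducedCohomology G n y₀ ⟶ reducedCohomology G n x₀ :=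
  Limits.kernel.map _ _ ((cohomology G n).map (TopCat.ofHom f.toMap).op) (𝟙 _) (by
    have h : basePoint x₀ ≫ TopCat.ofHom f.toMap = basePoint y₀ := by
      ext t
      exact f.map_base
    rw [Category.comp_id, ← Functor.map_comp, ← op_comp, h])

theorem homology_map_eq (G : AddCommGrpCat.{u}) (n : ℕ) {f g : C(X, Y)}
    (h : ContinuousMap.Homotopic f g) :
    (homology G n).map (TopCat.ofHom f) = (homology G n).map (TopCat.ofHom g) := by
  obtain ⟨H⟩ := h
  exact TopCat.Homotopy.congr_homologyMap_singularChainComplexFunctor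
    (f := TopCat.ofHom f) (g := TopCat.ofHom g) H G n

theorem cohomology_map_eq (G : AddCommGrpCat.{u}) (n : ℕ) {f g : C(X, Y)}
    (h : ContinuousMap.Homotopic f g) :
    (cohomology G n).map (TopCat.ofHom f).op = (cohomology G n).map (TopCat.ofHom g).op := by
  obtain ⟨H⟩ := h
  have h₁ : Homotopy ((chains intCoeff).map (TopCat.ofHom f))
      ((chains intCoeff).map (TopCat.ofHom g)) :=
    TopCat.Homotopy.singularChainComplexFunctorObjMap
      (f := TopCat.ofHom f) (g := TopCat.ofHom g) H intCoeff
  have h₂ := (preadditiveYoneda.obj G).mapHomotopy h₁.op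
  have h₃ := h₂.homologyMap_eq n
  exact h₃

/-- The homomorphism on reduced homology induced by a based homotopy class. -/
def BasedClass.homologyMap (G : AddCommGrpCat.{u}) (n : ℕ) {x₀ : X} {y₀ : Y}
    (α : BasedClass x₀ y₀) : reducedHomology G n X ⟶ reducedHomology G n Y :=
  Quotient.lift (s := basedSetoid x₀ y₀) (fun f => reducedHomologyMap G n f.toMap)
    (fun f g h => by
      have := homology_map_eq G n (ContinuousMap.HomotopicRel.homotopic h)
      unfold reducedHomologyMap
      congr 1) α

/-- The homomorphism on reduced cohomology induced by a based homotopy class. -/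
def BasedClass.cohomologyMap (G : AddCommGrpCat.{u}) (n : ℕ) {x₀ : X} {y₀ : Y}
    (α : BasedClass x₀ y₀) : reducedCohomology G n y₀ ⟶ reducedCohomology G n x₀ :=
  Quotient.lift (s := basedSetoid x₀ y₀) (fun f => reducedCohomologyMap G n f)
    (fun f g h => by
      have := cohomology_map_eq G n (ContinuousMap.HomotopicRel.homotopic h)
      unfold reducedCohomologyMap
      congr 1) α

end Induced

/-! ### `p`-local spaces of finite type -/

theorem isPrime_span (p : ℕ) [hp : Fact p.Prime] : (Ideal.span {(p : ℤ)}).IsPrime :=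
  (Ideal.span_singleton_prime (by exact_mod_cast hp.out.ne_zero)).2
    (Nat.prime_iff_prime_int.1 hp.out)

/-- `ℤ_(p)`, the integers localized at the prime ideal `(p)`. -/
abbrev IntLocalized (p : ℕ) [Fact p.Prime] : Type :=
  haveI := isPrime_span p
  Localization.AtPrime (Ideal.span {(p : ℤ)})

/-- A (simply connected) space is `p`-local if its homotopy groups are `p`-local, i.e. uniquely
divisible by every integer prime to `p`. -/
def IsPLocal (p : ℕ) {X : Type u} [TopologicalSpace X] (x₀ : X) : Prop :=
  ∀ n m : ℕ, m.Coprime p →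
    Function.Bijective (fun a : HomotopyGroup.Pi (n + 1) X x₀ => a ^ m)

/-- Each reduced integral homology group of `X` is a finitely generated `ℤ_(p)`-module. (An abelian
group carries at most one structure of `ℤ_(p)`-module.) -/
def HasFGLocalHomology (p : ℕ) [Fact p.Prime] (X : Type u) [TopologicalSpace X] : Prop :=
  ∀ n : ℕ, ∃ _ : Module (IntLocalized p) (reducedHomology intCoeff.{u} n X),
    Module.Finite (IntLocalized p) (reducedHomology intCoeff.{u} n X)

/-! ### Mod `p` self-closeness numbers -/

section Numbers

variable (p : ℕ) {X : Type u} [TopologicalSpace X] (x₀ : X)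

/-- `𝓐_*^k(X; p)`: the classes inducing isomorphisms on `H̃_i(X; ℤ/p)` for all `i ≤ k`. -/
def homologyMonoid (k : ℕ) : Set (BasedClass x₀ x₀) :=
  {α | ∀ i ≤ k, IsIso (α.homologyMap (modCoeff p) i)}

/-- `𝓐^*_k(X; p)`: the classes inducing isomorphisms on `H̃^i(X; ℤ/p)` for all `i ≤ k`. -/
def cohomologyMonoid (k : ℕ) : Set (BasedClass x₀ x₀) :=
  {α | ∀ i ≤ k, IsIso (α.cohomologyMap (modCoeff p) i)}

/-- `N_*𝓔(X; p) = min {k | 𝓐_*^k(X; p) = 𝓔(X)}`, which is `∞` if there is no such `k`. -/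
def homologySelfCloseness : ℕ∞ :=
  sInf ((fun k : ℕ => (k : ℕ∞)) '' {k | homologyMonoid p x₀ k = selfEquivalences x₀})

/-- `N^*𝓔(X; p) = min {k | 𝓐^*_k(X; p) = 𝓔(X)}`, which is `∞` if there is no such `k`. -/
def cohomologySelfCloseness : ℕ∞ :=
  sInf ((fun k : ℕ => (k : ℕ∞)) '' {k | cohomologyMonoid p x₀ k = selfEquivalences x₀})

end Numbers

end SelfCloseness

end

open CategoryTheory

noncomputable section

namespace SelfCloseness

universe u

/-! A based map induces an isomorphism on `H^n(-; ℤ/p)` exactly when it does on `H_n(-; ℤ/p)`,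
separately in each degree `n`. The two monoids therefore agree for every `k`, and so do the minima.

The reason is a duality `H^n(X; ℤ/p) ≅ Hom(H_n(X; ℤ/p), ℚ/ℤ)`, natural in `X`. At cochain level,
`Hom(C_*(X; ℤ), ℤ/p)`, `Hom(C_*(X; ℤ/p), ℤ/p)` and `Hom(C_*(X; ℤ/p), ℚ/ℤ)` are naturally isomorphic
(`isIso_dualChainsPrecomp`, `isIso_dualChainsPostcomp`). Since `ℚ/ℤ` is an injective cogenerator of
abelian groups, `Hom(-, ℚ/ℤ)` commutes with homology and reflects isomorphisms. The target `ℤ/p` is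
replaced by `ℚ/ℤ` because `ℤ/p` is not injective as an abelian group. `isIso_kernelMap_iff` passes
between reduced and unreduced groups. -/

/-! ### Reduced versus unreduced groups -/

section Abelian

variable {C : Type*} [Category C] [Abelian C]

/-- A morphism over `P` between objects whose structure maps to `P` admit a section is an
isomorphism if and only if the induced morphism between the kernels of the structure maps is. -/
theorem isIso_kernelMap_iff {A B P : C} (f : A ⟶ B) (a : A ⟶ P) (b : B ⟶ P) (s : P ⟶ A)
    (w : a ≫ 𝟙 P = f ≫ b) (hs : s ≫ a = 𝟙 P) :
    IsIso (Limits.kernel.map a b f (𝟙 P) w) ↔ IsIso f := by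
  constructor
  · intro h
    have w' : f ≫ b = a := by rw [← w, Category.comp_id]
    have hmono : Mono f := by
      refine Preadditive.mono_of_cancel_zero _ fun {T} x hx => ?_
      have hxa : x ≫ a = 0 := by rw [← w', ← Category.assoc, hx, Limits.zero_comp]
      have hk : Limits.kernel.lift a x hxa ≫ Limits.kernel.map a b f (𝟙 P) w = 0 := by
        rw [← cancel_mono (Limits.kernel.ι b)]
        simp [hx]
      have h0 : Limits.kernel.lift a x hxa = 0 := by
        rwa [← cancel_mono (Limits.kernel.map a b f (𝟙 P) w), Limits.zero_comp]
      rw [← Limits.kernel.lift_ι a x hxa, h0, Limits.zero_comp]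
    have hepi : Epi f := by
      refine Preadditive.epi_of_cancel_zero _ fun {T} y hy => ?_
      have hι : Limits.kernel.ι b ≫ y = 0 := by
        rw [← cancel_epi (Limits.kernel.map a b f (𝟙 P) w)]
        simp [hy]
      -- `s ≫ f` is a section of `b`, so this is the projection of `B` onto `ker b`. A `y` killed by
      -- `f` vanishes on both summands.
      have hz : (𝟙 B - b ≫ s ≫ f) ≫ b = 0 := by
        rw [Preadditive.sub_comp, Category.id_comp, Category.assoc, Category.assoc, w', hs,
          Category.comp_id, sub_self]
      have hy' : (𝟙 B - b ≫ s ≫ f) ≫ y = 0 := by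
        rw [← Limits.kernel.lift_ι b _ hz, Category.assoc, hι, Limits.comp_zero]
      simpa [Preadditive.sub_comp, hy] using hy'
    exact isIso_of_mono_of_epi f
  · intro h
    exact (Limits.kernel.mapIso a b (asIso f) (Iso.refl P) w).isIso_hom

end Abelian

section Reduced

variable {X : Type u} [TopologicalSpace X] {Y : Type u} [TopologicalSpace Y]

theorem basePoint_comp_collapse (x₀ : X) : basePoint x₀ ≫ collapse X = 𝟙 point := rfl

/-- The base point splits the collapse map. -/
theorem isIso_reducedHomologyMap_iff (G : AddCommGrpCat.{u}) (n : ℕ) {x₀ : X} {y₀ : Y}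
    (f : BasedMap x₀ y₀) :
    IsIso (reducedHomologyMap G n f.toMap) ↔
      IsIso ((homology G n).map (TopCat.ofHom f.toMap)) :=
  isIso_kernelMap_iff _ _ _ ((homology G n).map (basePoint x₀))
    (by
      rw [Category.comp_id, ← Functor.map_comp]
      rfl)
    (by rw [← Functor.map_comp, basePoint_comp_collapse, CategoryTheory.Functor.map_id])

/-- Contravariance swaps the roles: here the collapse map supplies the section. -/
theorem isIso_reducedCohomologyMap_iff (G : AddCommGrpCat.{u}) (n : ℕ) {x₀ : X} {y₀ : Y}
    (f : BasedMap x₀ y₀) :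
    IsIso (reducedCohomologyMap G n f) ↔
      IsIso ((cohomology G n).map (TopCat.ofHom f.toMap).op) :=
  isIso_kernelMap_iff _ _ _ ((cohomology G n).map (collapse Y).op)
    (by
      have h : basePoint x₀ ≫ TopCat.ofHom f.toMap = basePoint y₀ := by
        ext t
        exact f.map_base
      rw [Category.comp_id, ← Functor.map_comp, ← op_comp, h])
    (by rw [← Functor.map_comp, ← op_comp, basePoint_comp_collapse, op_id, CategoryTheory.Functor.map_id])

end Reduced

/-! ### Homology of the dual complex -/

section Dual

variable {ι : Type*} {c : ComplexShape ι}

/-- An exact functor that reflects isomorphisms detects isomorphisms on homology. -/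
theorem isIso_homologyMap_mapHomologicalComplex_iff {C D : Type*} [Category C] [Category D]
    [Abelian C] [Abelian D] (F : C ⥤ D) [F.Additive] [F.PreservesHomology]
    [F.ReflectsIsomorphisms] {K L : HomologicalComplex C c} (φ : K ⟶ L) (i : ι) :
    IsIso (HomologicalComplex.homologyMap ((F.mapHomologicalComplex c).map φ) i) ↔
      IsIso (HomologicalComplex.homologyMap φ i) := by
  have e := ShortComplex.mapHomologyIso_hom_naturality
    ((HomologicalComplex.shortComplexFunctor C c i).map φ) F
  rw [← isIso_iff_of_reflects_iso (HomologicalComplex.homologyMap φ i) F]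
  exact (MorphismProperty.isomorphisms D).arrow_mk_iso_iff
    (Arrow.isoMk _ _ e.symm)

theorem isIso_homologyMap_op_iff {C : Type*} [Category C] [Abelian C]
    {K L : HomologicalComplex C c} (φ : K ⟶ L) (i : ι) :
    IsIso (HomologicalComplex.homologyMap ((HomologicalComplex.opFunctor C c).map φ.op) i) ↔
      IsIso (HomologicalComplex.homologyMap φ i) := by
  rw [← isIso_op_iff (HomologicalComplex.homologyMap φ i)]
  exact NatIso.isIso_map_iff (HomologicalComplex.homologyOpNatIso C c i) φ.op

end Dual

/-! ### The group `ℚ/ℤ` -/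

/-- The additive group `ℚ/ℤ`, in the universe `u`. -/
abbrev circleCoeff : AddCommGrpCat.{u} := AddCommGrpCat.of (ULift.{u} (AddCircle (1 : ℚ)))

instance : Injective circleCoeff.{u} := AddCommGrpCat.injective_of_divisible _

theorem isCoseparator_circleCoeff : IsCoseparator circleCoeff.{u} := by
  rw [Preadditive.isCoseparator_iff]
  intro A B f hf
  ext a
  refine CharacterModule.eq_zero_of_character_apply fun χ => ?_
  have := hf (AddCommGrpCat.ofHom
    (AddEquiv.ulift.symm.toAddMonoidHom.comp (χ : B →+ AddCircle (1 : ℚ))))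
  have h := ConcreteCategory.congr_hom this a
  exact congrArg ULift.down h

/-- A faithful functor out of a balanced category reflects isomorphisms, which is how this instance
is used. -/
instance : (preadditiveYoneda.obj circleCoeff.{u}).Faithful :=
  (isCoseparator_iff_faithful_preadditiveYoneda _).1 isCoseparator_circleCoeff

/-- `Hom(-, J)` is always left exact; injectivity supplies the preservation of epimorphisms. -/
instance (J : AddCommGrpCat.{u}) [Injective J] : (preadditiveYoneda.obj J).PreservesHomology := by
  have : (preadditiveYoneda.obj J).PreservesEpimorphisms :=
    (Injective.injective_iff_preservesEpimorphisms_preadditiveYoneda_obj J).1 inferInstance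
  exact Functor.preservesHomology_of_preservesEpis_and_kernels _

/-! ### Change of coefficients -/

/-- The cochain complex `Hom(C_*(-; M), G)`. -/
abbrev dualChains (M G : AddCommGrpCat.{u}) :
    TopCat.{u}ᵒᵖ ⥤ HomologicalComplex AddCommGrpCat.{u} (ComplexShape.down ℕ).symm :=
  (chains M).op ⋙ HomologicalComplex.opFunctor AddCommGrpCat.{u} (ComplexShape.down ℕ) ⋙
    (preadditiveYoneda.obj G).mapHomologicalComplex (ComplexShape.down ℕ).symm

/-- The morphism `Hom(C_*(-; N), G) ⟶ Hom(C_*(-; M), G)` induced by `M ⟶ N`. -/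
def dualChainsPrecomp {M N : AddCommGrpCat.{u}} (q : M ⟶ N) (G : AddCommGrpCat.{u}) :
    dualChains N G ⟶ dualChains M G :=
  Functor.whiskerRight (NatTrans.op
    ((AlgebraicTopology.singularChainComplexFunctor AddCommGrpCat.{u}).map q)) _

/-- The morphism `Hom(C_*(-; M), G) ⟶ Hom(C_*(-; M), H)` induced by `G ⟶ H`. -/
def dualChainsPostcomp (M : AddCommGrpCat.{u}) {G H : AddCommGrpCat.{u}} (j : G ⟶ H) :
    dualChains M G ⟶ dualChains M H :=
  Functor.whiskerLeft (chains M).op (Functor.whiskerLeft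
    (HomologicalComplex.opFunctor AddCommGrpCat.{u} (ComplexShape.down ℕ))
    (NatTrans.mapHomologicalComplex (preadditiveYoneda.map j) _))

/-- `C_n(X; M)` is a coproduct of copies of `M` over the singular `n`-simplices, so it suffices to
check a single copy. -/
theorem isIso_dualChainsPrecomp {M N : AddCommGrpCat.{u}} (q : M ⟶ N) (G : AddCommGrpCat.{u})
    (h : Function.Bijective fun φ : N ⟶ G => q ≫ φ) : IsIso (dualChainsPrecomp q G) := by
  rw [NatTrans.isIso_iff_isIso_app]
  intro X
  refine @HomologicalComplex.Hom.isIso_of_components _ _ _ _ _ _ _ _ fun n => ?_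
  rw [ConcreteCategory.isIso_iff_bijective]
  let S : Type u := (TopCat.toSSet.obj X.unop).obj (.op (.mk n))
  change Function.Bijective fun φ : (∐ fun _ : S => N) ⟶ G => Limits.Sigma.map (fun _ => q) ≫ φ
  constructor
  · intro φ ψ e
    refine Limits.Sigma.hom_ext _ _ fun s => h.1 ?_
    have := congrArg (fun θ => Limits.Sigma.ι (fun _ : S => M) s ≫ θ) e
    simpa using this
  · intro ψ
    choose φ hφ using fun s : S => h.2 (Limits.Sigma.ι (fun _ : S => M) s ≫ ψ)
    refine ⟨Limits.Sigma.desc φ, Limits.Sigma.hom_ext _ _ fun s => ?_⟩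
    simpa using hφ s

theorem isIso_dualChainsPostcomp (M : AddCommGrpCat.{u}) {G H : AddCommGrpCat.{u}} (j : G ⟶ H)
    (h : Function.Bijective fun φ : M ⟶ G => φ ≫ j) : IsIso (dualChainsPostcomp M j) := by
  rw [NatTrans.isIso_iff_isIso_app]
  intro X
  refine @HomologicalComplex.Hom.isIso_of_components _ _ _ _ _ _ _ _ fun n => ?_
  rw [ConcreteCategory.isIso_iff_bijective]
  let S : Type u := (TopCat.toSSet.obj X.unop).obj (.op (.mk n))
  change Function.Bijective fun φ : (∐ fun _ : S => M) ⟶ G => φ ≫ j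
  constructor
  · intro φ ψ e
    refine Limits.Sigma.hom_ext _ _ fun s => h.1 ?_
    have := congrArg (fun θ => Limits.Sigma.ι (fun _ : S => M) s ≫ θ) e
    simpa using this
  · intro ψ
    choose φ hφ using fun s : S => h.2 (Limits.Sigma.ι (fun _ : S => M) s ≫ ψ)
    refine ⟨Limits.Sigma.desc φ, Limits.Sigma.hom_ext _ _ fun s => ?_⟩
    simpa using hφ s

/-- Reduction modulo `p`. -/
def modReduction (p : ℕ) : intCoeff.{u} ⟶ modCoeff.{u} p :=
  AddCommGrpCat.ofHom (AddEquiv.ulift.symm.toAddMonoidHom.comp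
    ((Int.castAddHom (ZMod p)).comp AddEquiv.ulift.toAddMonoidHom))

theorem modCoeff_hom_ext {p : ℕ} {G : AddCommGrpCat.{u}} {φ ψ : modCoeff.{u} p ⟶ G}
    (h : φ ⟨1⟩ = ψ ⟨1⟩) : φ = ψ := by
  ext ⟨x⟩
  obtain ⟨k, rfl⟩ := ZMod.intCast_surjective x
  have hk : (⟨(k : ZMod p)⟩ : ULift.{u} (ZMod p)) = k • (⟨1⟩ : ULift.{u} (ZMod p)) := by
    ext
    simp
  change φ.hom ⟨(k : ZMod p)⟩ = ψ.hom ⟨(k : ZMod p)⟩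
  rw [hk, map_zsmul, map_zsmul]
  exact congrArg _ h

/-- The homomorphism `ℤ/p → G` sending `1` to a given `p`-torsion element. -/
def modCoeffDesc {p : ℕ} {G : AddCommGrpCat.{u}} (g : G) (hg : p • g = 0) :
    modCoeff.{u} p ⟶ G :=
  AddCommGrpCat.ofHom ((ZMod.lift p ⟨zmultiplesHom G g, by simpa using hg⟩).comp
    AddEquiv.ulift.toAddMonoidHom)

theorem modCoeffDesc_intCast {p : ℕ} {G : AddCommGrpCat.{u}} (g : G) (hg : p • g = 0) (k : ℤ) :
    modCoeffDesc g hg ⟨(k : ZMod p)⟩ = k • g :=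
  ZMod.lift_coe p ⟨zmultiplesHom G g, by simpa using hg⟩ k

theorem modCoeffDesc_one {p : ℕ} {G : AddCommGrpCat.{u}} (g : G) (hg : p • g = 0) :
    modCoeffDesc g hg ⟨1⟩ = g := by
  simpa using modCoeffDesc_intCast g hg 1

theorem nsmul_modCoeff {p : ℕ} (x : modCoeff.{u} p) : p • x = 0 := by
  ext
  change p • x.down = 0
  simp

/-- A homomorphism `ℤ → ℤ/p` kills `p`, so it factors uniquely through the quotient. -/
theorem bijective_modReduction_comp (p : ℕ) :
    Function.Bijective fun φ : modCoeff.{u} p ⟶ modCoeff.{u} p => modReduction p ≫ φ := by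
  have h1 : modReduction.{u} p ⟨1⟩ = ⟨1⟩ := by
    ext
    change ((1 : ℤ) : ZMod p) = 1
    simp
  constructor
  · intro φ ψ e
    have := ConcreteCategory.congr_hom e ⟨1⟩
    refine modCoeff_hom_ext ?_
    rw [← h1]
    exact this
  · intro ψ
    refine ⟨modCoeffDesc (ψ ⟨1⟩) (nsmul_modCoeff _), ?_⟩
    refine AddCommGrpCat.hom_ext (AddMonoidHom.ext fun ⟨k⟩ => ?_)
    have hk : (⟨k⟩ : ULift.{u} ℤ) = k • (⟨1⟩ : ULift.{u} ℤ) := by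
      ext
      simp
    rw [hk, map_zsmul, map_zsmul]
    congr 1
    change modCoeffDesc (ψ ⟨1⟩) (nsmul_modCoeff _) (modReduction p ⟨1⟩) = ψ ⟨1⟩
    rw [h1, modCoeffDesc_one]

theorem nsmul_inv_circle (p : ℕ) [Fact p.Prime] :
    p • (⟨((p : ℚ)⁻¹ : ℚ)⟩ : circleCoeff.{u}) = 0 := by
  have hp : (p : ℚ) ≠ 0 := by exact_mod_cast (Fact.out : p.Prime).ne_zero
  ext
  change p • (((p : ℚ)⁻¹ : ℚ) : AddCircle (1 : ℚ)) = 0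
  rw [← AddCircle.coe_nsmul, nsmul_eq_mul, mul_inv_cancel₀ hp, AddCircle.coe_period]

/-- The embedding `ℤ/p → ℚ/ℤ`. -/
def modToCircle (p : ℕ) [Fact p.Prime] : modCoeff.{u} p ⟶ circleCoeff.{u} :=
  modCoeffDesc ⟨((p : ℚ)⁻¹ : ℚ)⟩ (nsmul_inv_circle p)

theorem modToCircle_intCast (p : ℕ) [Fact p.Prime] (k : ℤ) :
    modToCircle.{u} p ⟨(k : ZMod p)⟩ = ⟨((k / p : ℚ) : AddCircle (1 : ℚ))⟩ := by
  rw [modToCircle, modCoeffDesc_intCast]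
  ext
  change k • (((p : ℚ)⁻¹ : ℚ) : AddCircle (1 : ℚ)) = _
  rw [← AddCircle.coe_zsmul, zsmul_eq_mul, div_eq_mul_inv]

theorem modToCircle_injective (p : ℕ) [Fact p.Prime] :
    Function.Injective (modToCircle.{u} p) := by
  have hp : (p : ℚ) ≠ 0 := by exact_mod_cast (Fact.out : p.Prime).ne_zero
  refine (injective_iff_map_eq_zero (modToCircle.{u} p).hom).2 ?_
  rintro ⟨x⟩ hx
  obtain ⟨k, rfl⟩ := ZMod.intCast_surjective x
  have h := congrArg ULift.down ((modToCircle_intCast p k).symm.trans hx)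
  obtain ⟨m, hm⟩ := (AddCircle.coe_eq_zero_iff (1 : ℚ)).1 h
  rw [zsmul_eq_mul, mul_one, eq_div_iff hp] at hm
  have hk : k = m * p := by exact_mod_cast hm.symm
  ext
  change (k : ZMod p) = 0
  simp [hk]

theorem exists_modToCircle_eq (p : ℕ) [Fact p.Prime] (y : circleCoeff.{u}) (hy : p • y = 0) :
    ∃ x, modToCircle.{u} p x = y := by
  have hp : (p : ℚ) ≠ 0 := by exact_mod_cast (Fact.out : p.Prime).ne_zero
  obtain ⟨y⟩ := y
  obtain ⟨r, rfl⟩ := QuotientAddGroup.mk_surjective y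
  have h : ((p • r : ℚ) : AddCircle (1 : ℚ)) = 0 := congrArg ULift.down hy
  obtain ⟨m, hm⟩ := (AddCircle.coe_eq_zero_iff (1 : ℚ)).1 h
  refine ⟨⟨(m : ZMod p)⟩, ?_⟩
  rw [zsmul_eq_mul, mul_one, nsmul_eq_mul] at hm
  rw [modToCircle_intCast, hm, mul_div_cancel_left₀ _ hp]

/-- A homomorphism from `ℤ/p` to `ℚ/ℤ` lands in the `p`-torsion, which is the image of the
embedding. -/
theorem bijective_comp_modToCircle (p : ℕ) [Fact p.Prime] :
    Function.Bijective fun φ : modCoeff.{u} p ⟶ modCoeff.{u} p => φ ≫ modToCircle p := by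
  constructor
  · intro φ ψ e
    exact modCoeff_hom_ext (modToCircle_injective p (ConcreteCategory.congr_hom e ⟨1⟩))
  · intro ψ
    obtain ⟨x, hx⟩ := exists_modToCircle_eq p (ψ ⟨1⟩) (by
      rw [← map_nsmul ψ.hom, nsmul_modCoeff, map_zero])
    refine ⟨modCoeffDesc x (nsmul_modCoeff x), modCoeff_hom_ext ?_⟩
    change modToCircle p (modCoeffDesc x _ ⟨1⟩) = _
    rw [modCoeffDesc_one, hx]

/-! ### Duality between mod `p` homology and cohomology -/

/-- A map induces an isomorphism on `H^n(-; ℤ/p)` if and only if it does on `H_n(-; ℤ/p)`. -/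
theorem isIso_cohomology_map_iff (p : ℕ) [Fact p.Prime] (n : ℕ) {X Y : TopCat.{u}} (f : X ⟶ Y) :
    IsIso ((cohomology (modCoeff p) n).map f.op) ↔ IsIso ((homology (modCoeff p) n).map f) := by
  have := isIso_dualChainsPrecomp (modReduction.{u} p) _ (bijective_modReduction_comp p)
  have := isIso_dualChainsPostcomp _ _ (bijective_comp_modToCircle.{u} p)
  let e : dualChains intCoeff.{u} (modCoeff p) ≅ dualChains (modCoeff p) circleCoeff :=
    (asIso (dualChainsPrecomp (modReduction p) (modCoeff p))).symm ≪≫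
      asIso (dualChainsPostcomp (modCoeff p) (modToCircle p))
  -- Naturality of `e` in the space moves the question to `Hom(C_*(-; ℤ/p), ℚ/ℤ)`, where the exact
  -- conservative functor applies.
  rw [NatIso.isIso_map_iff (Functor.isoWhiskerRight e
    (HomologicalComplex.homologyFunctor AddCommGrpCat.{u} (ComplexShape.down ℕ).symm n)) f.op]
  exact (isIso_homologyMap_mapHomologicalComplex_iff (preadditiveYoneda.obj circleCoeff.{u})
    _ n).trans (isIso_homologyMap_op_iff ((chains (modCoeff p)).map f) n)

theorem isIso_cohomologyMap_iff (p : ℕ) [Fact p.Prime] (n : ℕ)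
    {X Y : Type u} [TopologicalSpace X] [TopologicalSpace Y] {x₀ : X} {y₀ : Y}
    (α : BasedClass x₀ y₀) :
    IsIso (α.cohomologyMap (modCoeff p) n) ↔ IsIso (α.homologyMap (modCoeff p) n) := by
  induction α using Quotient.inductionOn with
  | h f =>
    exact (isIso_reducedCohomologyMap_iff _ n f).trans
      ((isIso_cohomology_map_iff p n _).trans (isIso_reducedHomologyMap_iff _ n f).symm)

theorem cohomologyMonoid_eq_homologyMonoid (p : ℕ) [Fact p.Prime] {X : Type u}
    [TopologicalSpace X] (x₀ : X) (k : ℕ) : cohomologyMonoid p x₀ k = homologyMonoid p x₀ k := by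
  ext α
  exact forall₂_congr fun i _ => isIso_cohomologyMap_iff p i α

end SelfCloseness

end

theorem proposition3p4 (p : ℕ) [Fact p.Prime] (X : Type*) [TopologicalSpace X] [T2Space X]
    [Topology.CWComplex (Set.univ : Set X)] [SimplyConnectedSpace X] (x₀ : X)
    (hloc : SelfCloseness.IsPLocal p x₀) (hfg : SelfCloseness.HasFGLocalHomology p X) :
    SelfCloseness.cohomologySelfCloseness p x₀ = SelfCloseness.homologySelfCloseness p x₀ := by
  simp only [SelfCloseness.cohomologySelfCloseness, SelfCloseness.homologySelfCloseness,
    SelfCloseness.cohomologyMonoid_eq_homologyMonoid]
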